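/- Let $a,b\in\mathbb Z$ and $s=(a+b)/2$ with $s>2$. On $\mathbb Z^2$, with sites $z=(n,t)$, put $(\Box x)_{n,t}=x_{n,t+1}+x_{n+1,t}-4x_{n,t}+x_{n,t-1}+x_{n-1,t}$. The spatiotemporal cat map is the invertible map of the phase space $V=\prod_{n\in\mathbb Z}\mathbb T^2\ni (x_n,p_n)_n$ given modulo $1$ by $$x_n'=p_n-x_{n+1}+a\,x_n-x_{n-1},\qquad p_n'=b\,p_n+(ab-1)\,x_n-b\,(x_{n+1}+x_{n-1}),$$ and its natural measure $\mu$ is the product $\prod_n dx_n\,dp_n$ of Lebesgue measures. For an initial point of $V$ let $x_{n,t}\in[0,1)$ be the coordinate $x_n$ after $t\in\mathbb Z$ time steps, and let $m_z=\big((-\Box+2(s-2))x\big)_z\in\mathbb Z$ be its symbols. The alphabet is $\mathcal A=\{-3,-2,\dots,2s-1\}$ and the interior alphabet is $\mathcal A_0=\{0,1,\dots,2(s-2)\}$. Let $R=\{0,\dots,\ell_1-1\}\times\{0,\dots,\ell_2-1\}$ with $\ell_1,\ell_2\ge1$, and let $\partial R$ be the set of sites outside $R$ with a nearest neighbour in $R$;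 each $w\in\partial R$ has a unique neighbour $\bar w\in R$. Let $g=(g_{zz'})_{z,z'\in R}$ be the Dirichlet Green's function, i.e. the inverse of $-\Box+2(s-2)$ acting on functions on $R$ extended by $0$ outside $R$. For a block $M_R=(m_z)_{z\in R}$ of integers let $P(M_R)\subset\mathbb R^{\partial R}$ be the polytope of all $(x_w)_{w\in\partial R}$ with $$0\le x_w<1\ (w\in\partial R),\qquad 0\le\sum_{z'\in R}g_{zz'}m_{z'}+\sum_{w\in\partial R}g_{z\bar w}\,x_w<1\ (z\in R),$$ let $|P(M_R)|$ be its Lebesgue measure, and let $\mu(M_R)$ be the $\mu$-measure of the set of initial points whose symbols over a given translate $z_0+R$, $z_0\in\mathbb Z^2$, form the block $M_R$. Let $d(R)$ be given by $1/d(R)=\sum_{M_R\in\mathcal A^R}|P(M_R)|$. Then, for every $z_0\in\mathbb Z^2$, $d(R)$ is the constant factor in the factorization $\mu(M_R)=d(R)\,|P(M_R)|$, valid for all $M_R\in\mathcal A^R$; and if all symbols of $M_R$ lie in the interior alphabet $\mathcal A_0$, then $P(M_R)$ is the full unit hypercube $[0,1)^{\partial R}$, $|P(M_R)|=1$, and $\mu(M_R)=d(R)$,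 independently of the symbols. -/

import Mathlib

open MeasureTheory

namespace CatLattice

/-! ### The lattice `ℤ²`, sites `z = (n, t)` -/

/-- The discrete spacetime Laplacian on `ℤ²`. -/
def laplacian (x : ℤ × ℤ → ℝ) (z : ℤ × ℤ) : ℝ :=
  x (z + (0, 1)) + x (z + (1, 0)) - 4 * x z + x (z - (0, 1)) + x (z - (1, 0))

/-- The operator `-□ + 2(s-2)`. -/
def latticeOp (s : ℝ) (x : ℤ × ℤ → ℝ) (z : ℤ × ℤ) : ℝ :=
  -laplacian x z + 2 * (s - 2) * x z

/-- The four nearest neighbours of a site. -/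
def neighbors (z : ℤ × ℤ) : Finset (ℤ × ℤ) :=
  {z + (1, 0), z - (1, 0), z + (0, 1), z - (0, 1)}

/-- The exterior boundary `∂R`: sites outside `R` that have a neighbour in `R`. -/
def boundary (R : Finset (ℤ × ℤ)) : Finset (ℤ × ℤ) :=
  R.biUnion neighbors \ R

/-- The `ℓ₁ × ℓ₂` rectangle `{0, …, ℓ₁ - 1} × {0, …, ℓ₂ - 1}`. -/
noncomputable def rect (ℓ₁ ℓ₂ : ℕ) : Finset (ℤ × ℤ) :=
  Finset.Ico (0 : ℤ) ℓ₁ ×ˢ Finset.Ico (0 : ℤ) ℓ₂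

theorem mem_neighbors_comm {z w : ℤ × ℤ} (h : w ∈ neighbors z) : z ∈ neighbors w := by
  simp only [neighbors, Finset.mem_insert, Finset.mem_singleton] at h ⊢
  rcases h with h | h | h | h <;> subst h <;> simp

theorem exists_adjacent (R : Finset (ℤ × ℤ)) (w : boundary R) :
    ∃ z : R, (z : ℤ × ℤ) ∈ neighbors w := by
  obtain ⟨w, hw⟩ := w
  obtain ⟨z, hz, hwz⟩ := Finset.mem_biUnion.1 (Finset.mem_sdiff.1 hw).1
  exact ⟨⟨z, hz⟩, mem_neighbors_comm hwz⟩

/-- The site of `R` adjacent to the boundary site `w` (it is unique when `R` is a rectangle). -/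
noncomputable def adjacentSite (R : Finset (ℤ × ℤ)) (w : boundary R) : R :=
  (exists_adjacent R w).choose

/-! ### Dirichlet Green's function and the polytope of a block -/

/-- The matrix of `-□ + 2(s-2)` on functions on `R` extended by zero outside `R`. -/
noncomputable def dirichletMatrix (s : ℝ) (R : Finset (ℤ × ℤ)) : Matrix R R ℝ :=
  Matrix.of fun z z' => latticeOp s (Pi.single (z' : ℤ × ℤ) 1) z

/-- The Dirichlet Green's function of `R`: the inverse of `-□ + 2(s-2)` on `R` with zero boundary
values. -/
noncomputable def green (s : ℝ) (R : Finset (ℤ × ℤ)) : Matrix R R ℝ :=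
  (dirichletMatrix s R)⁻¹

/-- The approximate state determined by a block alone. -/
noncomputable def approxState (s : ℝ) (R : Finset (ℤ × ℤ)) (M : R → ℤ) (z : R) : ℝ :=
  ∑ z' : R, green s R z z' * (M z' : ℝ)

/-- The half-open unit hypercube `[0,1)^{∂R}`. -/
def hypercube (R : Finset (ℤ × ℤ)) : Set (boundary R → ℝ) :=
  {x | ∀ i, 0 ≤ x i ∧ x i < 1}

/-- The polytope of the block `M` over `R`, in the Euclidean space of boundary values. -/
def polytope (s : ℝ) (R : Finset (ℤ × ℤ)) (M : R → ℤ) : Set (boundary R → ℝ) :=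
  {x | (∀ i, 0 ≤ x i ∧ x i < 1) ∧
    ∀ z : R, 0 ≤ approxState s R M z + ∑ i, green s R z (adjacentSite R i) * x i ∧
      approxState s R M z + ∑ i, green s R z (adjacentSite R i) * x i < 1}

/-! ### Alphabets -/

/-- The alphabet `{-3, -2, …, 2s - 1}`. -/
def alphabet (s : ℝ) : Set ℤ := {m | -3 ≤ m ∧ (m : ℝ) ≤ 2 * s - 1}

/-- The interior alphabet `{0, …, 2(s - 2)}`. -/
def interiorAlphabet (s : ℝ) : Set ℤ := {m | 0 ≤ m ∧ (m : ℝ) ≤ 2 * (s - 2)}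

/-- The factor `d(R)` of the `ℓ₁ × ℓ₂` rectangle, fixed by the normalization
`1 / d(R) = ∑ |P(M)|`, the sum being over all blocks of symbols of the alphabet. -/
noncomputable def dFactor (s : ℝ) (ℓ₁ ℓ₂ : ℕ) : ENNReal :=
  (∑' M : {M : rect ℓ₁ ℓ₂ → ℤ // ∀ z, M z ∈ alphabet s},
    volume (polytope s (rect ℓ₁ ℓ₂) M.1))⁻¹

/-! ### Dynamics and the natural measure -/

/-- The phase space `∏_{n ∈ ℤ} 𝕋²` of the infinite chain; a point is `(xₙ, pₙ)ₙ`. -/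
abbrev PhaseSpace : Type := ℤ → UnitAddCircle × UnitAddCircle

/-- One time step of the chain of coupled cat maps, modulo one:
`xₙ' = pₙ - xₙ₊₁ + a xₙ - xₙ₋₁`, `pₙ' = b pₙ + (ab - 1) xₙ - b (xₙ₊₁ + xₙ₋₁)`. -/
noncomputable def timeStep (a b : ℤ) : Equiv.Perm PhaseSpace where
  toFun v n :=
    ((v n).2 - (v (n + 1)).1 + a • (v n).1 - (v (n - 1)).1,
      b • (v n).2 + (a * b - 1) • (v n).1 - b • ((v (n + 1)).1 + (v (n - 1)).1))
  invFun w n :=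
    (b • (w n).1 - (w n).2,
      (w n).1 + (b • (w (n + 1)).1 - (w (n + 1)).2) - a • (b • (w n).1 - (w n).2)
        + (b • (w (n - 1)).1 - (w (n - 1)).2))
  left_inv v := by
    funext n
    ext <;> module
  right_inv w := by
    funext n
    ext <;> module

instance isProbabilityMeasure_circle :
    IsProbabilityMeasure (volume : Measure UnitAddCircle) :=
  ⟨UnitAddCircle.measure_univ⟩

instance isProbabilityMeasure_torus :
    IsProbabilityMeasure (volume : Measure (UnitAddCircle × UnitAddCircle)) := by
  rw [Measure.volume_eq_prod]
  infer_instance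

/-- The natural measure `∏ dxₙ dpₙ` on the phase space of the infinite chain. -/
noncomputable def naturalMeasure : Measure PhaseSpace :=
  Measure.infinitePi fun _ : ℤ => (volume : Measure (UnitAddCircle × UnitAddCircle))

instance isProbabilityMeasure_naturalMeasure : IsProbabilityMeasure naturalMeasure := by
  rw [naturalMeasure]
  infer_instance

/-- The spatiotemporal state of the initial point `v`: at `z = (n, t)`, the coordinate `xₙ` after
`t` time steps, represented in `[0,1)`. -/
noncomputable def field (a b : ℤ) (v : PhaseSpace) (z : ℤ × ℤ) : ℝ :=
  AddCircle.equivIco 1 0 (((timeStep a b) ^ z.2) v z.1).1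

/-- The set of points whose spatiotemporal state has, over the translate `z₀ + R`, the symbols
`(-□ + 2(s-2)) x` prescribed by the block `M` over `R`. -/
def cylinder (a b : ℤ) (s : ℝ) (z₀ : ℤ × ℤ) (R : Finset (ℤ × ℤ)) (M : R → ℤ) : Set PhaseSpace :=
  {v | ∀ z : R, latticeOp s (field a b v) (z₀ + z) = (M z : ℝ)}

end CatLattice

/-! Boundary values are natural coordinates for the polytope but not for the dynamics: the map from
`V` to the state mod 1 on `∂R` need not be uniform in a way that inverts over the integers. The free
sites (rows `t = -1, 0` under and in `R`, plus the two side columns) repair this: the top boundary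
row is traded for the row `t = 0`. The lattice equation can be solved for the topmost or outermost
neighbour with coefficient one, so over any abelian group the free values are arbitrary
(`exists_solution_eq_on_freeSites`) and determine the solution on the closed rectangle
(`eq_zero_on_closedRect`).

Over the circle this makes observation on the free sites a surjective homomorphism; it carries the
natural measure to Haar measure (`map_observe`). Hence `μ(M)` is the volume of the set of free
values of real admissible fields (`measure_cylinder`). Over the reals, boundary and free values of
homogeneous solutions are related by a linear bijection independent of `M`, so this volume is a
fixed multiple of `|P(M)|` (`exists_volume_freeValues`). As the cylinders partition phase space, the
multiple is `d(R)`. For interior symbols the maximum principle makes every boundary condition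
admissible (`polytope_eq_hypercube`). -/

namespace CatLattice

/-! ### The lattice equation over an abelian group -/

section LatticeEquation

variable {A : Type*} [AddCommGroup A]

/-- The operator `-□ + c - 4` on fields over `ℤ²` with values in an abelian group. -/
def groupOp (c : ℤ) (X : ℤ × ℤ → A) (z : ℤ × ℤ) : A :=
  c • X z - (X (z + (0, 1)) + X (z - (0, 1)) + X (z + (1, 0)) + X (z - (1, 0)))

theorem groupOp_mk (c : ℤ) (X : ℤ × ℤ → A) (n t : ℤ) :
    groupOp c X (n, t) =
      c • X (n, t) - (X (n, t + 1) + X (n, t - 1) + X (n + 1, t) + X (n - 1, t)) := by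
  simp [groupOp]

theorem groupOp_sub (c : ℤ) (X Y : ℤ × ℤ → A) (z : ℤ × ℤ) :
    groupOp c (X - Y) z = groupOp c X z - groupOp c Y z := by
  simp only [groupOp, Pi.sub_apply, smul_sub]
  abel

theorem groupOp_translate (c : ℤ) (X : ℤ × ℤ → A) (z₀ z : ℤ × ℤ) :
    groupOp c (fun w => X (z₀ + w)) z = groupOp c X (z₀ + z) := by
  simp only [groupOp, add_assoc, add_sub_assoc]

theorem map_groupOp {B : Type*} [AddCommGroup B] (φ : A →+ B) (c : ℤ) (X : ℤ × ℤ → A)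
    (z : ℤ × ℤ) : groupOp c (fun w => φ (X w)) z = φ (groupOp c X z) := by
  simp [groupOp]

/-- A second-order recursion on `ℤ` is solvable with arbitrary values at `-1` and `0`. -/
theorem exists_secondOrder_solution (f : ℤ → A → A) (u v : A) :
    ∃ x : ℤ → A, x (-1) = u ∧ x 0 = v ∧ ∀ k, x (k + 1) + x (k - 1) = f k (x k) := by
  -- Both iterations carry two consecutive values: `g k` is `(x (k-1), x k)` and `h k` is `(x
  -- (-k-1), x (-k))`.
  let g : ℕ → A × A := fun k =>
    k.rec (u, v) fun k p => (p.2, f k p.2 - p.1)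
  let h : ℕ → A × A := fun k =>
    k.rec (u, v) fun k p => (f (Int.negSucc k) p.1 - p.2, p.1)
  have hg (k : ℕ) : g (k + 1) = ((g k).2, f k (g k).2 - (g k).1) := rfl
  have hh (k : ℕ) : h (k + 1) = (f (Int.negSucc k) (h k).1 - (h k).2, (h k).1) := rfl
  let x : ℤ → A := fun k => Int.casesOn k (fun k => (g k).2) (fun k => (h k).1)
  have xg (k : ℕ) : x k = (g k).2 := rfl
  have xh (k : ℕ) : x (Int.negSucc k) = (h k).1 := rfl
  refine ⟨x, rfl, rfl, fun k => ?_⟩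
  rcases k with k | k
  · rcases k with _ | k
    · change (g (0 + 1)).2 + (h 0).1 = f 0 (g 0).2
      rw [hg]
      simp [g, h]
    · have e1 : (Int.ofNat (k + 1) : ℤ) + 1 = ((k + 2 : ℕ) : ℤ) := by simp; ring
      have e2 : (Int.ofNat (k + 1) : ℤ) - 1 = ((k : ℕ) : ℤ) := by simp
      rw [e1, e2, xg, xg, hg (k + 1), hg k]
      change _ = f ((k + 1 : ℕ) : ℤ) (g (k + 1)).2
      rw [hg k]
      simp
  · rcases k with _ | k
    · change (g 0).2 + (h (0 + 1)).1 = f (Int.negSucc 0) (h 0).1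
      rw [hh]
      simp [g, h]
    · have e1 : Int.negSucc (k + 1) + 1 = Int.negSucc k := by simp [Int.negSucc_eq]
      have e2 : Int.negSucc (k + 1) - 1 = Int.negSucc (k + 2) := by
        simp only [Int.negSucc_eq]; push_cast; ring
      rw [e1, e2, xh k, xh (k + 1), xh (k + 2), hh (k + 1), hh k]
      simp

/-- The sites on which a solution of the lattice equation over the `ℓ₁ × ℓ₂` rectangle can be
prescribed freely, if it is evolved upwards in time. -/
noncomputable def freeSites (ℓ₁ ℓ₂ : ℕ) : Finset (ℤ × ℤ) :=
  Finset.Ico (0 : ℤ) ℓ₁ ×ˢ {-1, 0} ∪ {-1, (ℓ₁ : ℤ)} ×ˢ Finset.Ico (0 : ℤ) ℓ₂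

/-- A solution of the lattice equation can be prescribed on the free sites. -/
theorem exists_solution_eq_on_freeSites (c : ℤ) {ℓ₁ : ℕ} (hℓ₁ : 0 < ℓ₁) (ℓ₂ : ℕ)
    (y : ℤ × ℤ → A) :
    ∃ X : ℤ × ℤ → A, (∀ z, groupOp c X z = 0) ∧ ∀ w ∈ freeSites ℓ₁ ℓ₂, X w = y w := by
  -- In the strip over the rectangle the equation is solved in time, with the prescribed side values
  -- overriding each row outside the strip.
  let glue : ℤ → (ℤ → A) → ℤ → A := fun t row n =>
    if 0 ≤ n ∧ n < ℓ₁ then row n else y (n, t)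
  obtain ⟨rows, hr0, hr1, hr⟩ := exists_secondOrder_solution
    (fun t row n => c • glue t row n - glue t row (n + 1) - glue t row (n - 1))
    (fun n => y (n, -1)) (fun n => y (n, 0))
  let mid : ℤ → ℤ → A := fun n t => glue t (rows t) n
  have mid_in (n t : ℤ) (hn : 0 ≤ n ∧ n < ℓ₁) : mid n t = rows t n := if_pos hn
  have mid_out (n t : ℤ) (hn : ¬ (0 ≤ n ∧ n < ℓ₁)) : mid n t = y (n, t) := if_neg hn
  have hmid (n t : ℤ) (hn : 0 ≤ n ∧ n < ℓ₁) :
      mid n (t + 1) + mid n (t - 1) = c • mid n t - mid (n + 1) t - mid (n - 1) t := by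
    rw [mid_in n (t + 1) hn, mid_in n (t - 1) hn]
    exact congrFun (hr t) n
  -- Beyond the strip space takes the role of time: whole columns are evolved outwards from two
  -- known adjacent columns.
  have cols (u v : ℤ → A) := exists_secondOrder_solution
    (fun _ col (t : ℤ) => c • col t - col (t + 1) - col (t - 1)) u v
  obtain ⟨R, hR0, hR1, hR⟩ := cols (mid (ℓ₁ - 1)) (mid ℓ₁)
  obtain ⟨L, hL0, hL1, hL⟩ := cols (mid (-1)) (mid 0)
  -- Neighbouring pieces agree on two columns, so the three columns in each instance of the equation
  -- always lie in a single piece.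
  let X : ℤ → ℤ → A := fun n =>
    if n < 0 then L n else if (ℓ₁ : ℤ) ≤ n then R (n - ℓ₁) else mid n
  have XL (n : ℤ) (hn : n ≤ 0) : X n = L n := by
    rcases hn.lt_or_eq with h | rfl
    · exact if_pos h
    · simp [X, hℓ₁.ne', hL1]
  have XR (n : ℤ) (hn : (ℓ₁ : ℤ) - 1 ≤ n) : X n = R (n - ℓ₁) := by
    have h0 : ¬ n < 0 := by omega
    rcases hn.lt_or_eq with h | rfl
    · have h1 : (ℓ₁ : ℤ) ≤ n := by omega
      simp [X, h0, h1]
    · have : (ℓ₁ : ℤ) - 1 - ℓ₁ = -1 := by ring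
      simp [X, this, hR0]
      omega
  have XM (n : ℤ) (h0 : -1 ≤ n) (h1 : n ≤ ℓ₁) : X n = mid n := by
    by_cases h : n < 0
    · obtain rfl : n = -1 := by omega
      rw [XL _ (by simp), hL0]
    · by_cases h' : (ℓ₁ : ℤ) ≤ n
      · obtain rfl : n = ℓ₁ := by omega
        rw [XR _ (by simp), sub_self, hR1]
      · simp [X, h, h']
  refine ⟨fun z => X z.1 z.2, ?_, ?_⟩
  · rintro ⟨n, t⟩
    rw [groupOp_mk, sub_eq_zero]
    simp only
    rcases lt_or_ge n 0 with h0 | h0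
    · rw [XL n h0.le, XL (n + 1) (by omega), XL (n - 1) (by omega)]
      have := congrFun (hL n) t
      simp only [Pi.add_apply] at this
      rw [add_assoc, this]
      abel
    rcases lt_or_ge n (ℓ₁ : ℤ) with h1 | h1
    · rw [XM n (by omega) h1.le, XM (n + 1) (by omega) (by omega),
        XM (n - 1) (by omega) (by omega), hmid n t ⟨h0, h1⟩]
      abel
    · rw [XR n (by omega), XR (n + 1) (by omega), XR (n - 1) (by omega)]
      have := congrFun (hR (n - ℓ₁)) t
      simp only [Pi.add_apply] at this
      rw [add_assoc, show n + 1 - (ℓ₁ : ℤ) = n - ℓ₁ + 1 by ring,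
        show n - 1 - (ℓ₁ : ℤ) = n - ℓ₁ - 1 by ring, this]
      abel
  · rintro ⟨n, t⟩ hw
    simp only [freeSites, Finset.mem_union, Finset.mem_product, Finset.mem_Ico,
      Finset.mem_insert, Finset.mem_singleton] at hw
    simp only
    rw [XM n (by omega) (by omega)]
    rcases hw with ⟨hn, rfl | rfl⟩ | ⟨hn, ht⟩
    · rw [mid_in _ _ hn, hr0]
    · rw [mid_in _ _ hn, hr1]
    · exact mid_out _ _ (by omega)

/-! ### Geometry of the rectangle and uniqueness from the free values -/

theorem mem_rect {ℓ₁ ℓ₂ : ℕ} {n t : ℤ} :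
    (n, t) ∈ rect ℓ₁ ℓ₂ ↔ (0 ≤ n ∧ n < ℓ₁) ∧ 0 ≤ t ∧ t < ℓ₂ := by
  simp [rect]

theorem mem_boundary_rect {ℓ₁ ℓ₂ : ℕ} {n t : ℤ} :
    (n, t) ∈ boundary (rect ℓ₁ ℓ₂) ↔
      ((n = -1 ∨ n = ℓ₁) ∧ 0 ≤ t ∧ t < ℓ₂) ∧ 0 < ℓ₁ ∨
      ((t = -1 ∨ t = ℓ₂) ∧ 0 ≤ n ∧ n < ℓ₁) ∧ 0 < ℓ₂ := by
  simp only [boundary, neighbors, Finset.mem_sdiff, Finset.mem_biUnion, mem_rect, Prod.exists,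
    Finset.mem_insert, Finset.mem_singleton, Prod.mk_add_mk, Prod.mk_sub_mk, Prod.mk.injEq]
  constructor
  · rintro ⟨⟨n', t', h⟩, h'⟩
    omega
  · rintro (⟨⟨rfl | rfl, h⟩, h'⟩ | ⟨⟨rfl | rfl, h⟩, h'⟩)
    · exact ⟨⟨0, t, by omega⟩, by omega⟩
    · exact ⟨⟨ℓ₁ - 1, t, by omega⟩, by omega⟩
    · exact ⟨⟨n, 0, by omega⟩, by omega⟩
    · exact ⟨⟨n, ℓ₂ - 1, by omega⟩, by omega⟩

/-- The closure of the rectangle: its sites and its boundary sites. -/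
noncomputable def closedRect (ℓ₁ ℓ₂ : ℕ) : Finset (ℤ × ℤ) := rect ℓ₁ ℓ₂ ∪ boundary (rect ℓ₁ ℓ₂)

theorem mem_closedRect {ℓ₁ ℓ₂ : ℕ} (hℓ₁ : 0 < ℓ₁) (hℓ₂ : 0 < ℓ₂) {n t : ℤ} :
    (n, t) ∈ closedRect ℓ₁ ℓ₂ ↔
      (-1 ≤ n ∧ n ≤ ℓ₁) ∧ (0 ≤ t ∧ t < ℓ₂) ∨ (0 ≤ n ∧ n < ℓ₁) ∧ (-1 ≤ t ∧ t ≤ ℓ₂) := by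
  rw [closedRect, Finset.mem_union, mem_rect, mem_boundary_rect]
  omega

theorem freeSites_subset_closedRect {ℓ₁ ℓ₂ : ℕ} (hℓ₁ : 0 < ℓ₁) (hℓ₂ : 0 < ℓ₂) :
    freeSites ℓ₁ ℓ₂ ⊆ closedRect ℓ₁ ℓ₂ := by
  rintro ⟨n, t⟩ hw
  rw [mem_closedRect hℓ₁ hℓ₂]
  simp only [freeSites, Finset.mem_union, Finset.mem_product, Finset.mem_Ico,
    Finset.mem_insert, Finset.mem_singleton] at hw
  omega

theorem neighbors_subset_closedRect {ℓ₁ ℓ₂ : ℕ} {z : ℤ × ℤ} (hz : z ∈ rect ℓ₁ ℓ₂) :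
    neighbors z ⊆ closedRect ℓ₁ ℓ₂ := by
  intro w hw
  by_cases h : w ∈ rect ℓ₁ ℓ₂
  · exact Finset.mem_union_left _ h
  · exact Finset.mem_union_right _
      (Finset.mem_sdiff.2 ⟨Finset.mem_biUnion.2 ⟨z, hz, hw⟩, h⟩)

/-- A solution over the rectangle is determined by its values on the free sites. -/
theorem eq_zero_on_closedRect {c : ℤ} {ℓ₁ ℓ₂ : ℕ} (hℓ₁ : 0 < ℓ₁) (hℓ₂ : 0 < ℓ₂)
    {X : ℤ × ℤ → A} (hX : ∀ z ∈ rect ℓ₁ ℓ₂, groupOp c X z = 0)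
    (hF : ∀ w ∈ freeSites ℓ₁ ℓ₂, X w = 0) : ∀ z ∈ closedRect ℓ₁ ℓ₂, X z = 0 := by
  have bottom (n t : ℤ) (hn : 0 ≤ n ∧ n < ℓ₁) (ht : t = -1 ∨ t = 0) : X (n, t) = 0 :=
    hF _ (by simp [freeSites, hn, ht])
  have sides (n t : ℤ) (hn : n = -1 ∨ n = ℓ₁) (ht : 0 ≤ t ∧ t < ℓ₂) : X (n, t) = 0 :=
    hF _ (by simp [freeSites, hn, ht])
  -- Two vanishing consecutive rows and vanishing sides force the next row to vanish; the last step
  -- reaches the top boundary row `t = ℓ₂`.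
  have key (k : ℕ) : k ≤ ℓ₂ → ∀ n : ℤ, 0 ≤ n ∧ n < ℓ₁ → X (n, k) = 0 ∧ X (n, k - 1) = 0 := by
    induction k with
    | zero => exact fun _ n hn => ⟨bottom _ _ hn (by simp), bottom _ _ hn (by simp)⟩
    | succ k ih =>
      intro hk n hn
      have hrow (n : ℤ) (hn : -1 ≤ n ∧ n ≤ ℓ₁) : X (n, k) = 0 := by
        by_cases h : 0 ≤ n ∧ n < ℓ₁
        · exact (ih (by omega) n h).1
        · exact sides _ _ (by omega) (by omega)
      have h := hX (n, k) (mem_rect.2 ⟨hn, by omega⟩)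
      rw [groupOp_mk, hrow n (by omega), hrow (n + 1) (by omega), hrow (n - 1) (by omega),
        (ih (by omega) n hn).2] at h
      push_cast
      rw [add_sub_cancel_right, hrow n (by omega)]
      simpa using h
  rintro ⟨n, t⟩ hz
  rw [mem_closedRect hℓ₁ hℓ₂] at hz
  by_cases hn : 0 ≤ n ∧ n < ℓ₁
  · rcases lt_or_ge t 0 with ht | ht
    · exact bottom _ _ hn (by omega)
    · lift t to ℕ using ht
      exact (key t (by omega) n hn).1
  · exact sides _ _ (by omega) (by omega)

end LatticeEquation

/-! ### Green's function and the polytope -/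

theorem sum_neighbors {A : Type*} [AddCommMonoid A] (X : ℤ × ℤ → A) (z : ℤ × ℤ) :
    ∑ w ∈ neighbors z, X w =
      X (z + (0, 1)) + X (z - (0, 1)) + X (z + (1, 0)) + X (z - (1, 0)) := by
  obtain ⟨n, t⟩ := z
  rw [neighbors, Finset.sum_insert, Finset.sum_insert, Finset.sum_insert, Finset.sum_singleton]
  · abel
  all_goals
    simp only [Finset.mem_insert, Finset.mem_singleton, Prod.mk_add_mk, Prod.mk_sub_mk,
      Prod.mk.injEq]
    omega

theorem latticeOp_eq (s : ℝ) (x : ℤ × ℤ → ℝ) (z : ℤ × ℤ) :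
    latticeOp s x z = 2 * s * x z - ∑ w ∈ neighbors z, x w := by
  rw [sum_neighbors, latticeOp, laplacian]
  ring

theorem latticeOp_eq_groupOp {s : ℝ} {c : ℤ} (hc : 2 * s = c) (x : ℤ × ℤ → ℝ) (z : ℤ × ℤ) :
    latticeOp s x z = groupOp c x z := by
  rw [latticeOp_eq, sum_neighbors, groupOp, hc, zsmul_eq_mul]

theorem latticeOp_sub (s : ℝ) (x y : ℤ × ℤ → ℝ) (z : ℤ × ℤ) :
    latticeOp s (x - y) z = latticeOp s x z - latticeOp s y z := by
  simp only [latticeOp, laplacian, Pi.sub_apply]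
  ring

theorem latticeOp_add (s : ℝ) (x y : ℤ × ℤ → ℝ) (z : ℤ × ℤ) :
    latticeOp s (x + y) z = latticeOp s x z + latticeOp s y z := by
  simp only [latticeOp, laplacian, Pi.add_apply]
  ring

theorem latticeOp_smul (s r : ℝ) (x : ℤ × ℤ → ℝ) (z : ℤ × ℤ) :
    latticeOp s (r • x) z = r * latticeOp s x z := by
  simp only [latticeOp, laplacian, Pi.smul_apply, smul_eq_mul]
  ring

theorem notMem_neighbors_self (z : ℤ × ℤ) : z ∉ neighbors z := by
  obtain ⟨n, t⟩ := z
  simp only [neighbors, Finset.mem_insert, Finset.mem_singleton, Prod.mk_add_mk, Prod.mk_sub_mk,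
    Prod.mk.injEq]
  omega

theorem card_neighbors (z : ℤ × ℤ) : (neighbors z).card = 4 := by
  rw [Finset.card_eq_sum_ones, sum_neighbors]

theorem dirichletMatrix_apply (s : ℝ) (R : Finset (ℤ × ℤ)) (z z' : R) :
    dirichletMatrix s R z z' =
      (if z = z' then 2 * s else 0) - if (z' : ℤ × ℤ) ∈ neighbors z then 1 else 0 := by
  rw [dirichletMatrix, Matrix.of_apply, latticeOp_eq]
  congr 1
  · by_cases h : z = z'
    · simp [h]
    · have : (z : ℤ × ℤ) ≠ z' := fun e => h (Subtype.ext e)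
      simp [h, this]
  · simp only [Pi.single_apply]
    rw [Finset.sum_ite_eq']

/-- Strict diagonal dominance: the diagonal is `2s > 4`, while a row has at most four off-diagonal
entries `-1`. -/
theorem isUnit_det_dirichletMatrix {s : ℝ} (hs : 2 < s) (R : Finset (ℤ × ℤ)) :
    IsUnit (dirichletMatrix s R).det := by
  rw [isUnit_iff_ne_zero]
  refine det_ne_zero_of_sum_row_lt_diag fun z => ?_
  have h1 : dirichletMatrix s R z z = 2 * s := by
    simp [dirichletMatrix_apply, notMem_neighbors_self]
  have h2 : ∑ z' ∈ Finset.univ.erase z, ‖dirichletMatrix s R z z'‖ ≤ 4 := by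
    calc ∑ z' ∈ Finset.univ.erase z, ‖dirichletMatrix s R z z'‖
        = ∑ z' ∈ Finset.univ.erase z, if (z' : ℤ × ℤ) ∈ neighbors z then (1 : ℝ) else 0 := by
          refine Finset.sum_congr rfl fun z' hz' => ?_
          rw [dirichletMatrix_apply, if_neg (Finset.ne_of_mem_erase hz').symm]
          split_ifs <;> simp
      _ ≤ ∑ z' : R, if (z' : ℤ × ℤ) ∈ neighbors z then (1 : ℝ) else 0 :=
          Finset.sum_le_sum_of_subset_of_nonneg (Finset.erase_subset _ _)
            fun _ _ _ => by split_ifs <;> simp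
      _ = ∑ z' ∈ R, if z' ∈ neighbors z then (1 : ℝ) else 0 :=
          Finset.sum_coe_sort R fun z' => if z' ∈ neighbors z then (1 : ℝ) else 0
      _ = ((R ∩ neighbors z).card : ℝ) := by
          rw [Finset.sum_ite_mem, Finset.sum_const, nsmul_one]
      _ ≤ 4 := by
          have := Finset.card_le_card (Finset.inter_subset_right (s₁ := R) (s₂ := neighbors z))
          rw [card_neighbors] at this
          exact_mod_cast this
  rw [h1, Real.norm_eq_abs, abs_of_pos (by linarith)]
  linarith

/-- A rectangle has neither gaps nor reentrant corners. This makes the choice in `adjacentSite`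
canonical. -/
theorem neighbor_unique {ℓ₁ ℓ₂ : ℕ} {w z z' : ℤ × ℤ} (hw : w ∉ rect ℓ₁ ℓ₂)
    (hz : z ∈ rect ℓ₁ ℓ₂) (hz' : z' ∈ rect ℓ₁ ℓ₂) (h : z ∈ neighbors w)
    (h' : z' ∈ neighbors w) : z = z' := by
  obtain ⟨n, t⟩ := w
  obtain ⟨n₁, t₁⟩ := z
  obtain ⟨n₂, t₂⟩ := z'
  simp only [neighbors, Finset.mem_insert, Finset.mem_singleton, Prod.mk_add_mk, Prod.mk_sub_mk,
    Prod.mk.injEq, mem_rect] at *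
  omega

theorem adjacentSite_eq_iff {ℓ₁ ℓ₂ : ℕ} (w : boundary (rect ℓ₁ ℓ₂)) (z : rect ℓ₁ ℓ₂) :
    adjacentSite _ w = z ↔ (w : ℤ × ℤ) ∈ neighbors z := by
  have h := (exists_adjacent _ w).choose_spec
  have hw : (w : ℤ × ℤ) ∉ rect ℓ₁ ℓ₂ := (Finset.mem_sdiff.1 w.2).2
  constructor
  · rintro rfl
    exact mem_neighbors_comm h
  · exact fun hz => Subtype.ext
      (neighbor_unique hw (adjacentSite _ w).2 z.2 h (mem_neighbors_comm hz))

/-- The lattice operator on the rectangle splits into its Dirichlet part and the contribution of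
the boundary values. -/
theorem latticeOp_eq_mulVec {s : ℝ} {ℓ₁ ℓ₂ : ℕ} (x : ℤ × ℤ → ℝ) (z : rect ℓ₁ ℓ₂) :
    latticeOp s x z = (dirichletMatrix s (rect ℓ₁ ℓ₂)).mulVec (fun z' => x z') z -
      ∑ w : boundary (rect ℓ₁ ℓ₂), if adjacentSite _ w = z then x w else 0 := by
  have hsub := Finset.inter_eq_right.2 (neighbors_subset_closedRect z.2)
  have hdisj : Disjoint (rect ℓ₁ ℓ₂) (boundary (rect ℓ₁ ℓ₂)) := Finset.disjoint_sdiff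
  have h1 : ∑ w ∈ neighbors z, x w =
      ∑ w ∈ closedRect ℓ₁ ℓ₂, if w ∈ neighbors (z : ℤ × ℤ) then x w else 0 := by
    rw [Finset.sum_ite_mem, hsub]
  rw [latticeOp_eq, h1, closedRect, Finset.sum_union hdisj,
    ← Finset.sum_coe_sort (rect ℓ₁ ℓ₂), ← Finset.sum_coe_sort (boundary _)]
  simp only [adjacentSite_eq_iff, Matrix.mulVec, dotProduct, dirichletMatrix_apply, sub_mul,
    ite_mul, zero_mul, one_mul, Finset.sum_sub_distrib]
  rw [Finset.sum_ite_eq]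
  simp only [Finset.mem_univ, if_true]
  ring

/-- A field has the symbols `M` over the rectangle iff it is given there by the Green's function
formula. -/
theorem latticeOp_eq_iff_green {s : ℝ} (hs : 2 < s) {ℓ₁ ℓ₂ : ℕ} (M : rect ℓ₁ ℓ₂ → ℤ)
    (x : ℤ × ℤ → ℝ) :
    (∀ z : rect ℓ₁ ℓ₂, latticeOp s x z = M z) ↔
      ∀ z : rect ℓ₁ ℓ₂, x z = approxState s _ M z +
        ∑ w : boundary (rect ℓ₁ ℓ₂), green s _ z (adjacentSite _ w) * x w := by
  set D := dirichletMatrix s (rect ℓ₁ ℓ₂)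
  have hD : IsUnit D.det := isUnit_det_dirichletMatrix hs _
  let β : rect ℓ₁ ℓ₂ → ℝ := fun z =>
    ∑ w : boundary (rect ℓ₁ ℓ₂), if adjacentSite _ w = z then x w else 0
  have h1 : (∀ z : rect ℓ₁ ℓ₂, latticeOp s x z = M z) ↔
      D.mulVec (fun z => x z) = (fun z => (M z : ℝ)) + β := by
    rw [funext_iff]
    refine forall_congr' fun z => ?_
    rw [latticeOp_eq_mulVec, Pi.add_apply, sub_eq_iff_eq_add]
  have h2 : (∀ z : rect ℓ₁ ℓ₂, x z = approxState s _ M z +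
        ∑ w : boundary (rect ℓ₁ ℓ₂), green s _ z (adjacentSite _ w) * x w) ↔
      (fun z : rect ℓ₁ ℓ₂ => x z) = D⁻¹.mulVec ((fun z => (M z : ℝ)) + β) := by
    rw [funext_iff]
    refine forall_congr' fun z => ?_
    have : D⁻¹.mulVec β z =
        ∑ w : boundary (rect ℓ₁ ℓ₂), green s _ z (adjacentSite _ w) * x w := by
      simp only [Matrix.mulVec, dotProduct, β, Finset.mul_sum, mul_ite, mul_zero]
      rw [Finset.sum_comm]
      refine Finset.sum_congr rfl fun w _ => ?_
      rw [Finset.sum_ite_eq]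
      simp [green, D]
    rw [Matrix.mulVec_add, Pi.add_apply, this]
    rfl
  rw [h1, h2]
  constructor
  · intro h
    rw [← h, Matrix.mulVec_mulVec, Matrix.nonsing_inv_mul _ hD, Matrix.one_mulVec]
  · intro h
    rw [h, Matrix.mulVec_mulVec, Matrix.mul_nonsing_inv _ hD, Matrix.one_mulVec]

/-- The field with the given boundary values and the symbols `M` over the rectangle. -/
theorem exists_field_of_boundary {s : ℝ} (hs : 2 < s) {ℓ₁ ℓ₂ : ℕ} (M : rect ℓ₁ ℓ₂ → ℤ)
    (p : boundary (rect ℓ₁ ℓ₂) → ℝ) :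
    ∃ x : ℤ × ℤ → ℝ, (∀ w : boundary (rect ℓ₁ ℓ₂), x w = p w) ∧
      ∀ z : rect ℓ₁ ℓ₂, latticeOp s x z = M z := by
  let x : ℤ × ℤ → ℝ := fun z =>
    if h : z ∈ rect ℓ₁ ℓ₂ then approxState s _ M ⟨z, h⟩ +
        ∑ w : boundary (rect ℓ₁ ℓ₂), green s _ ⟨z, h⟩ (adjacentSite _ w) * p w
    else if h : z ∈ boundary (rect ℓ₁ ℓ₂) then p ⟨z, h⟩ else 0
  have hx (w : boundary (rect ℓ₁ ℓ₂)) : x w = p w := by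
    have : (w : ℤ × ℤ) ∉ rect ℓ₁ ℓ₂ := (Finset.mem_sdiff.1 w.2).2
    simp [x, this]
  refine ⟨x, hx, (latticeOp_eq_iff_green hs M x).2 fun z => ?_⟩
  simp only [hx]
  simp [x]

/-- The fields with values in `[0,1)` on the closed rectangle and with the symbols `M` over the
rectangle. -/
def admissible (s : ℝ) {ℓ₁ ℓ₂ : ℕ} (M : rect ℓ₁ ℓ₂ → ℤ) : Set (ℤ × ℤ → ℝ) :=
  {x | (∀ z ∈ closedRect ℓ₁ ℓ₂, 0 ≤ x z ∧ x z < 1) ∧ ∀ z : rect ℓ₁ ℓ₂, latticeOp s x z = M z}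

theorem mem_admissible_iff {s : ℝ} (hs : 2 < s) {ℓ₁ ℓ₂ : ℕ} (M : rect ℓ₁ ℓ₂ → ℤ)
    {x : ℤ × ℤ → ℝ} (hx : ∀ z : rect ℓ₁ ℓ₂, latticeOp s x z = M z) :
    x ∈ admissible s M ↔
      (fun w : boundary (rect ℓ₁ ℓ₂) => x w) ∈ polytope s (rect ℓ₁ ℓ₂) M := by
  have h := (latticeOp_eq_iff_green hs M x).1 hx
  simp only [admissible, polytope, Set.mem_ofPred_eq, ← h, closedRect, Finset.mem_union]
  exact ⟨fun H => ⟨fun w => H.1 w (.inr w.2), fun z => H.1 z (.inl z.2)⟩,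
    fun H => ⟨fun z hz => hz.elim (fun h => H.2 ⟨z, h⟩) fun h => H.1 ⟨z, h⟩, hx⟩⟩

/-- The polytope consists of the boundary values of admissible fields. -/
theorem polytope_eq_image {s : ℝ} (hs : 2 < s) {ℓ₁ ℓ₂ : ℕ} (M : rect ℓ₁ ℓ₂ → ℤ) :
    polytope s (rect ℓ₁ ℓ₂) M =
      (fun x (w : boundary (rect ℓ₁ ℓ₂)) => x (w : ℤ × ℤ)) '' admissible s M := by
  ext p
  constructor
  · intro hp
    obtain ⟨x, hxp, hx⟩ := exists_field_of_boundary hs M p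
    obtain rfl : (fun w : boundary (rect ℓ₁ ℓ₂) => x w) = p := funext hxp
    exact ⟨x, (mem_admissible_iff hs M hx).2 hp, rfl⟩
  · rintro ⟨x, hx, rfl⟩
    exact (mem_admissible_iff hs M hx.2).1 hx

theorem hypercube_volume (R : Finset (ℤ × ℤ)) : volume (hypercube R) = 1 := by
  have : hypercube R = Set.univ.pi fun _ => Set.Ico (0 : ℝ) 1 := by
    ext x
    simp [hypercube]
  rw [this, volume_pi_pi]
  simp

/-- By the maximum principle, interior symbols put no restriction on the boundary values. -/
theorem polytope_eq_hypercube {s : ℝ} (hs : 2 < s) {ℓ₁ ℓ₂ : ℕ} (hℓ₁ : 0 < ℓ₁) (hℓ₂ : 0 < ℓ₂)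
    {M : rect ℓ₁ ℓ₂ → ℤ} (hM : ∀ z, M z ∈ interiorAlphabet s) :
    polytope s (rect ℓ₁ ℓ₂) M = hypercube (rect ℓ₁ ℓ₂) := by
  refine Set.Subset.antisymm (fun p hp => hp.1) fun p hp => ?_
  obtain ⟨x, hxp, hx⟩ := exists_field_of_boundary hs M p
  obtain rfl : (fun w : boundary (rect ℓ₁ ℓ₂) => x w) = p := funext hxp
  refine (mem_admissible_iff hs M hx).1 ⟨?_, hx⟩
  have hb (w : ℤ × ℤ) (hw : w ∈ boundary (rect ℓ₁ ℓ₂)) : 0 ≤ x w ∧ x w < 1 := hp ⟨w, hw⟩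
  have hcl {z w : ℤ × ℤ} (hz : z ∈ rect ℓ₁ ℓ₂) (hw : w ∈ neighbors z) :
      w ∈ rect ℓ₁ ℓ₂ ∨ w ∈ boundary (rect ℓ₁ ℓ₂) :=
    Finset.mem_union.1 (neighbors_subset_closedRect hz hw)
  have hne : (rect ℓ₁ ℓ₂).Nonempty := ⟨(0, 0), mem_rect.2 (by omega)⟩
  have lower : ∀ z ∈ rect ℓ₁ ℓ₂, 0 ≤ x z := by
    obtain ⟨z, hz, hmin⟩ := Finset.exists_min_image _ x hne
    suffices 0 ≤ x z from fun z' hz' => this.trans (hmin z' hz')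
    by_contra! hneg
    -- At a negative minimum the equation would give `2s x z ≥ 4 x z`, which contradicts `s > 2`.
    have hsum : (neighbors z).card • x z ≤ ∑ w ∈ neighbors z, x w := by
      refine Finset.card_nsmul_le_sum _ _ _ fun w hw => ?_
      rcases hcl hz hw with h | h
      · exact hmin w h
      · exact hneg.le.trans (hb w h).1
    have h := hx ⟨z, hz⟩
    have hm : (0 : ℝ) ≤ M ⟨z, hz⟩ := by exact_mod_cast (hM ⟨z, hz⟩).1
    rw [latticeOp_eq] at h
    rw [card_neighbors, nsmul_eq_mul] at hsum
    push_cast at hsum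
    nlinarith
  have upper : ∀ z ∈ rect ℓ₁ ℓ₂, x z < 1 := by
    -- Symbols may equal `2(s-2)`, so a plain maximum yields only `x z ≤ 1`. Breaking ties by the
    -- largest `n` makes the right neighbour strictly smaller, and the inequality strict.
    obtain ⟨z, hz, hmax⟩ := Finset.exists_max_image _ (fun z => toLex (x z, z.1)) hne
    have hle : ∀ z' ∈ rect ℓ₁ ℓ₂, x z' ≤ x z := fun z' hz' =>
      (Prod.Lex.monotone_fst_ofLex (hmax z' hz'))
    suffices x z < 1 from fun z' hz' => (hle z' hz').trans_lt this
    by_contra! hbig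
    have hsum : ∑ w ∈ neighbors z, x w < ∑ w ∈ neighbors z, x z := by
      refine Finset.sum_lt_sum (fun w hw => ?_) ⟨z + (1, 0), by simp [neighbors], ?_⟩
      · rcases hcl hz hw with h | h
        · exact hle w h
        · exact (hb w h).2.le.trans hbig
      · rcases hcl hz (w := z + (1, 0)) (by simp [neighbors]) with h | h
        · have := hmax _ h
          rw [Prod.Lex.toLex_le_toLex] at this
          rcases this with this | ⟨-, this⟩
          · exact this
          · simp at this
        · exact (hb _ h).2.trans_le hbig
    have h := hx ⟨z, hz⟩
    have hm := (hM ⟨z, hz⟩).2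
    rw [latticeOp_eq] at h
    rw [Finset.sum_const, card_neighbors, nsmul_eq_mul] at hsum
    push_cast at hsum
    nlinarith
  intro z hz
  rcases Finset.mem_union.1 hz with h | h
  · exact ⟨lower z h, upper z h⟩
  · exact hb z h

theorem measurableSet_polytope (s : ℝ) (R : Finset (ℤ × ℤ)) (M : R → ℤ) :
    MeasurableSet (polytope s R M) := by
  unfold polytope
  measurability

/-! ### Change of coordinates from the boundary values to the free values -/

/-- The boundary values and the values on the free sites of a solution of the homogeneous lattice
equation over the rectangle correspond to each other linearly and bijectively. -/
theorem exists_boundary_equiv_freeSites {s : ℝ} (hs : 2 < s) {c : ℤ} (hc : 2 * s = c)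
    {ℓ₁ ℓ₂ : ℕ} (hℓ₁ : 0 < ℓ₁) (hℓ₂ : 0 < ℓ₂) :
    ∃ Φ : (boundary (rect ℓ₁ ℓ₂) → ℝ) ≃ₗ[ℝ] (freeSites ℓ₁ ℓ₂ → ℝ),
      ∀ x : ℤ × ℤ → ℝ, (∀ z ∈ rect ℓ₁ ℓ₂, latticeOp s x z = 0) →
        Φ (fun w => x w) = fun w : freeSites ℓ₁ ℓ₂ => x w := by
  -- Homogeneous solutions, cut off outside the closed rectangle so that restriction can be
  -- injective. Restriction to the boundary and to the free sites are both bijective on `K`; `Φ` is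
  -- the transition between them.
  let K : Submodule ℝ (ℤ × ℤ → ℝ) :=
    { carrier := {x | (∀ z ∈ rect ℓ₁ ℓ₂, latticeOp s x z = 0) ∧
        ∀ z ∉ closedRect ℓ₁ ℓ₂, x z = 0}
      zero_mem' := ⟨fun z _ => by simp [latticeOp, laplacian], fun _ _ => rfl⟩
      add_mem' := fun {x y} hx hy =>
        ⟨fun z hz => by rw [latticeOp_add, hx.1 z hz, hy.1 z hz, add_zero],
          fun z hz => by rw [Pi.add_apply, hx.2 z hz, hy.2 z hz, add_zero]⟩
      smul_mem' := fun r x hx =>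
        ⟨fun z hz => by rw [latticeOp_smul, hx.1 z hz, mul_zero],
          fun z hz => by rw [Pi.smul_apply, hx.2 z hz, smul_zero]⟩ }
  let restr (S : Finset (ℤ × ℤ)) : K →ₗ[ℝ] (S → ℝ) :=
    { toFun := fun x w => x.1 w
      map_add' := fun _ _ => rfl
      map_smul' := fun _ _ => rfl }
  have trunc (x : ℤ × ℤ → ℝ) (hx : ∀ z ∈ rect ℓ₁ ℓ₂, latticeOp s x z = 0) :
      ∃ k : K, ∀ z ∈ closedRect ℓ₁ ℓ₂, k.1 z = x z := by
    refine ⟨⟨fun z => if z ∈ closedRect ℓ₁ ℓ₂ then x z else 0, fun z hz => ?_,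
      fun z hz => if_neg hz⟩, fun z hz => if_pos hz⟩
    rw [← hx z hz, latticeOp_eq, latticeOp_eq]
    have hz' : z ∈ closedRect ℓ₁ ℓ₂ := Finset.mem_union_left _ hz
    congr 1
    · rw [if_pos hz']
    · exact Finset.sum_congr rfl fun w hw => if_pos (neighbors_subset_closedRect hz hw)
  have inj {S : Finset (ℤ × ℤ)} (h : ∀ k : K, (∀ w ∈ S, k.1 w = 0) →
      ∀ z ∈ closedRect ℓ₁ ℓ₂, k.1 z = 0) : Function.Injective (restr S) := by
    rw [injective_iff_map_eq_zero]
    intro k hk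
    ext z
    by_cases hz : z ∈ closedRect ℓ₁ ℓ₂
    · exact h k (fun w hw => congrFun hk ⟨w, hw⟩) z hz
    · exact k.2.2 z hz
  have surj {S : Finset (ℤ × ℤ)} (hS : S ⊆ closedRect ℓ₁ ℓ₂)
      (h : ∀ p : S → ℝ, ∃ x : ℤ × ℤ → ℝ, (∀ z ∈ rect ℓ₁ ℓ₂, latticeOp s x z = 0) ∧
        ∀ w : S, x w = p w) : Function.Surjective (restr S) := by
    intro p
    obtain ⟨x, hx, hxp⟩ := h p
    obtain ⟨k, hk⟩ := trunc x hx
    exact ⟨k, funext fun w => (hk w (hS w.2)).trans (hxp w)⟩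
  have bijB : Function.Bijective (restr (boundary (rect ℓ₁ ℓ₂))) := by
    constructor
    · refine inj fun k hk z hz => ?_
      rcases Finset.mem_union.1 hz with h | h
      · rw [(latticeOp_eq_iff_green hs 0 k.1).1 (fun z => by simpa using k.2.1 z z.2) ⟨z, h⟩]
        simp only [approxState, Pi.zero_apply, Int.cast_zero, mul_zero, Finset.sum_const_zero,
          zero_add]
        exact Finset.sum_eq_zero fun w _ => by rw [hk w w.2, mul_zero]
      · exact hk z h
    · refine surj Finset.subset_union_right fun p => ?_
      obtain ⟨x, hxp, hx⟩ := exists_field_of_boundary hs 0 p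
      exact ⟨x, fun z hz => by simpa using hx ⟨z, hz⟩, hxp⟩
  have bijF : Function.Bijective (restr (freeSites ℓ₁ ℓ₂)) := by
    constructor
    · refine inj fun k hk => eq_zero_on_closedRect (c := c) hℓ₁ hℓ₂ (fun z hz => ?_) hk
      rw [← latticeOp_eq_groupOp hc, k.2.1 z hz]
    · refine surj (freeSites_subset_closedRect hℓ₁ hℓ₂) fun p => ?_
      obtain ⟨x, hx, hxp⟩ := exists_solution_eq_on_freeSites c hℓ₁ ℓ₂
        (fun z => if h : z ∈ freeSites ℓ₁ ℓ₂ then p ⟨z, h⟩ else 0)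
      exact ⟨x, fun z _ => by rw [latticeOp_eq_groupOp hc, hx],
        fun w => by rw [hxp w w.2, dif_pos w.2]⟩
  refine ⟨(LinearEquiv.ofBijective _ bijB).symm.trans (LinearEquiv.ofBijective _ bijF),
    fun x hx => ?_⟩
  obtain ⟨k, hk⟩ := trunc x hx
  have hB : (fun w : boundary (rect ℓ₁ ℓ₂) => x w) = LinearEquiv.ofBijective _ bijB k :=
    funext fun w => (hk w (Finset.mem_union_right _ w.2)).symm
  rw [hB, LinearEquiv.trans_apply, LinearEquiv.symm_apply_apply]
  exact funext fun w => hk w (freeSites_subset_closedRect hℓ₁ hℓ₂ w.2)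

/-- The values on the free sites of the admissible fields. -/
def freeValues (s : ℝ) {ℓ₁ ℓ₂ : ℕ} (M : rect ℓ₁ ℓ₂ → ℤ) : Set (freeSites ℓ₁ ℓ₂ → ℝ) :=
  (fun x (w : freeSites ℓ₁ ℓ₂) => x (w : ℤ × ℤ)) '' admissible s M

/-- Fields with the same symbols differ by a homogeneous solution, so `M` enters the change of
coordinates only through the translation `y₀`: the free values of the field with symbols `M` and
zero boundary values. -/
theorem exists_freeValues_eq_preimage {s : ℝ} (hs : 2 < s) {c : ℤ} (hc : 2 * s = c)
    {ℓ₁ ℓ₂ : ℕ} (hℓ₁ : 0 < ℓ₁) (hℓ₂ : 0 < ℓ₂) :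
    ∃ Φ : (boundary (rect ℓ₁ ℓ₂) → ℝ) ≃L[ℝ] (freeSites ℓ₁ ℓ₂ → ℝ),
      ∀ M : rect ℓ₁ ℓ₂ → ℤ, ∃ y₀ : freeSites ℓ₁ ℓ₂ → ℝ,
        freeValues s M = {y | Φ.symm (y - y₀) ∈ polytope s (rect ℓ₁ ℓ₂) M} := by
  obtain ⟨Φ, hΦ⟩ := exists_boundary_equiv_freeSites hs hc hℓ₁ hℓ₂
  refine ⟨Φ.toContinuousLinearEquiv, fun M => ?_⟩
  obtain ⟨x₀, hx₀, hM⟩ := exists_field_of_boundary hs M 0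
  have key {x : ℤ × ℤ → ℝ} (hx : x ∈ admissible s M) :
      Φ (fun w => x w) = fun w : freeSites ℓ₁ ℓ₂ => x w - x₀ w := by
    have := hΦ (x - x₀) fun z hz => by
      rw [latticeOp_sub, hx.2 ⟨z, hz⟩, hM ⟨z, hz⟩, sub_self]
    simp only [Pi.sub_apply, hx₀, Pi.zero_apply, sub_zero] at this
    exact this
  refine ⟨fun w => x₀ w, ?_⟩
  rw [polytope_eq_image hs]
  ext y
  simp only [Set.mem_ofPred_eq]
  constructor
  · rintro ⟨x, hx, rfl⟩
    exact ⟨x, hx, (LinearEquiv.eq_symm_apply Φ).2 (key hx)⟩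
  · rintro ⟨x, hx, hxy⟩
    have h := (LinearEquiv.eq_symm_apply Φ).1 hxy
    rw [key hx] at h
    exact ⟨x, hx, funext fun w => sub_left_injective (congrFun h w)⟩

theorem measurableSet_freeValues {s : ℝ} (hs : 2 < s) {c : ℤ} (hc : 2 * s = c)
    {ℓ₁ ℓ₂ : ℕ} (hℓ₁ : 0 < ℓ₁) (hℓ₂ : 0 < ℓ₂) (M : rect ℓ₁ ℓ₂ → ℤ) :
    MeasurableSet (freeValues s M) := by
  obtain ⟨Φ, hΦ⟩ := exists_freeValues_eq_preimage hs hc hℓ₁ hℓ₂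
  obtain ⟨y₀, h⟩ := hΦ M
  rw [h]
  exact measurableSet_preimage (f := fun y => Φ.symm (y - y₀)) (by fun_prop)
    (measurableSet_polytope _ _ _)

/-- Translations preserve volume and a linear bijection scales it by a constant, here a ratio of
Haar measures because the two index types differ. -/
theorem exists_volume_freeValues {s : ℝ} (hs : 2 < s) {c : ℤ} (hc : 2 * s = c)
    {ℓ₁ ℓ₂ : ℕ} (hℓ₁ : 0 < ℓ₁) (hℓ₂ : 0 < ℓ₂) :
    ∃ d : ENNReal, ∀ M : rect ℓ₁ ℓ₂ → ℤ,
      volume (freeValues s M) = d * volume (polytope s (rect ℓ₁ ℓ₂) M) := by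
  obtain ⟨Φ, hΦ⟩ := exists_freeValues_eq_preimage hs hc hℓ₁ hℓ₂
  let ν : Measure (boundary (rect ℓ₁ ℓ₂) → ℝ) := Measure.map Φ.symm volume
  have : ν.IsAddHaarMeasure := Φ.symm.isAddHaarMeasure_map volume
  refine ⟨ν.addHaarScalarFactor volume, fun M => ?_⟩
  obtain ⟨y₀, h⟩ := hΦ M
  have h1 : freeValues s M = (fun y => y - y₀) ⁻¹' (Φ.symm ⁻¹' polytope s (rect ℓ₁ ℓ₂) M) := h
  have h2 : ν = ν.addHaarScalarFactor volume • volume := Measure.isAddLeftInvariant_eq_smul _ _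
  simp only [sub_eq_add_neg] at h1
  rw [h1, measure_preimage_add_right,
    ← Measure.map_apply Φ.symm.continuous.measurable (measurableSet_polytope _ _ _)]
  change ν _ = _
  conv_lhs => rw [h2]
  rfl

/-! ### Dynamics -/

/-- The spatiotemporal state of the initial point `v`, modulo one. -/
noncomputable def circleField (a b : ℤ) (v : PhaseSpace) (z : ℤ × ℤ) : UnitAddCircle :=
  (((timeStep a b) ^ z.2) v z.1).1

theorem field_eq (a b : ℤ) (v : PhaseSpace) (z : ℤ × ℤ) :
    field a b v z = AddCircle.equivIco 1 0 (circleField a b v z) := rfl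

theorem coe_field (a b : ℤ) (v : PhaseSpace) (z : ℤ × ℤ) :
    (field a b v z : UnitAddCircle) = circleField a b v z :=
  (AddCircle.equivIco 1 0).symm_apply_apply _

theorem field_mem (a b : ℤ) (v : PhaseSpace) (z : ℤ × ℤ) :
    0 ≤ field a b v z ∧ field a b v z < 1 := by
  have := (AddCircle.equivIco 1 0 (circleField a b v z)).2
  exact ⟨this.1, this.2.trans_eq (zero_add 1)⟩

theorem timeStep_apply (a b : ℤ) (v : PhaseSpace) (n : ℤ) :
    timeStep a b v n =
      ((v n).2 - (v (n + 1)).1 + a • (v n).1 - (v (n - 1)).1,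
        b • (v n).2 + (a * b - 1) • (v n).1 - b • ((v (n + 1)).1 + (v (n - 1)).1)) := rfl

theorem timeStep_inv_apply (a b : ℤ) (w : PhaseSpace) (n : ℤ) :
    (timeStep a b)⁻¹ w n =
      (b • (w n).1 - (w n).2,
        (w n).1 + (b • (w (n + 1)).1 - (w (n + 1)).2) - a • (b • (w n).1 - (w n).2)
          + (b • (w (n - 1)).1 - (w (n - 1)).2)) := rfl

/-- A property of permutations that passes to products passes to integer powers. -/
theorem zpow_induction {G : Type*} [Group G] (P : G → Prop) (h1 : P 1)
    (hmul : ∀ g h, P g → P h → P (g * h)) {g : G} (hg : P g) (hg' : P g⁻¹) (t : ℤ) :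
    P (g ^ t) := by
  induction t using Int.induction_on with
  | zero => simpa using h1
  | succ k ih => rw [zpow_add_one]; exact hmul _ _ ih hg
  | pred k ih => rw [zpow_sub_one]; exact hmul _ _ ih hg'

theorem measurable_timeStep_zpow (a b : ℤ) (t : ℤ) : Measurable ⇑((timeStep a b) ^ t) := by
  refine zpow_induction (fun e : Equiv.Perm PhaseSpace => Measurable ⇑e) measurable_id
    (fun g h hg hh => hg.comp hh) ?_ ?_ t
  · refine measurable_pi_lambda _ fun n => ?_
    simp only [timeStep_apply]
    fun_prop
  · refine measurable_pi_lambda _ fun n => ?_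
    simp only [timeStep_inv_apply]
    fun_prop

theorem timeStep_zpow_add (a b : ℤ) (t : ℤ) (v w : PhaseSpace) :
    ((timeStep a b) ^ t) (v + w) = ((timeStep a b) ^ t) v + ((timeStep a b) ^ t) w := by
  refine zpow_induction (fun e : Equiv.Perm PhaseSpace => ∀ v w, e (v + w) = e v + e w)
    (fun _ _ => rfl) (fun g h hg hh v w => ?_) (fun v w => ?_) (fun v w => ?_) t v w
  · simp only [Equiv.Perm.mul_apply, hh, hg]
  · funext n
    simp only [timeStep_apply, Pi.add_apply, Prod.fst_add, Prod.snd_add, Prod.mk_add_mk]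
    ext <;> module
  · funext n
    simp only [timeStep_inv_apply, Pi.add_apply, Prod.fst_add, Prod.snd_add, Prod.mk_add_mk]
    ext <;> module

theorem measurable_circleField (a b : ℤ) (z : ℤ × ℤ) :
    Measurable fun v => circleField a b v z :=
  ((measurable_pi_apply z.1).comp (measurable_timeStep_zpow a b z.2)).fst

theorem measurable_field (a b : ℤ) (z : ℤ × ℤ) : Measurable fun v => field a b v z :=
  measurable_subtype_coe.comp
    ((AddCircle.measurableEquivIco 1 0).measurable.comp (measurable_circleField a b z))

theorem circleField_add (a b : ℤ) (v w : PhaseSpace) (z : ℤ × ℤ) :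
    circleField a b (v + w) z = circleField a b v z + circleField a b w z := by
  simp [circleField, timeStep_zpow_add]

/-- The state obeys the lattice equation modulo one. -/
theorem groupOp_circleField (a b : ℤ) (v : PhaseSpace) (z : ℤ × ℤ) :
    groupOp (a + b) (circleField a b v) z = 0 := by
  obtain ⟨n, t⟩ := z
  rw [groupOp_mk]
  simp only [circleField]
  rw [show t + 1 = 1 + t by ring, show t - 1 = -1 + t by ring, zpow_add, zpow_add, zpow_one,
    zpow_neg_one]
  simp only [Equiv.Perm.mul_apply, timeStep_apply, timeStep_inv_apply]
  module

/-- Every solution of the lattice equation modulo one is the state of some initial point. -/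
theorem exists_circleField_eq (a b : ℤ) {X : ℤ × ℤ → UnitAddCircle}
    (hX : ∀ z, groupOp (a + b) X z = 0) : ∃ v, circleField a b v = X := by
  have hX' (n t : ℤ) : X (n, t + 1) =
      (a + b) • X (n, t) - (X (n, t - 1) + X (n + 1, t) + X (n - 1, t)) := by
    have := hX (n, t)
    rw [groupOp_mk, sub_eq_zero] at this
    rw [this]
    abel
  -- The momentum is read off from the inverse map, whose first component `b x - p` is the preceding
  -- `x`.
  let row : ℤ → PhaseSpace := fun t n => (X (n, t), b • X (n, t) - X (n, t - 1))
  have hstep (t : ℤ) : timeStep a b (row t) = row (t + 1) := by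
    funext n
    simp only [timeStep_apply, row, add_sub_cancel_right, hX']
    ext <;> module
  have key (t : ℤ) : ((timeStep a b) ^ t) (row 0) = row t := by
    induction t using Int.induction_on with
    | zero => rfl
    | succ k ih => rw [add_comm, zpow_add, zpow_one, Equiv.Perm.mul_apply, ih, hstep, add_comm]
    | pred k ih =>
      rw [sub_eq_neg_add, zpow_add, zpow_neg_one, Equiv.Perm.mul_apply, ih, Equiv.Perm.inv_eq_iff_eq,
        hstep]
      congr 1
      ring
  exact ⟨row 0, funext fun z => by simp only [circleField, key, row]⟩

/-! ### The law of the state on the free sites -/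

/-- The state over a finite set of sites, translated by `z₀`. -/
noncomputable def observe (a b : ℤ) (z₀ : ℤ × ℤ) (F : Finset (ℤ × ℤ)) (v : PhaseSpace)
    (w : F) : UnitAddCircle :=
  circleField a b v (z₀ + w)

theorem measurable_observe (a b : ℤ) (z₀ : ℤ × ℤ) (F : Finset (ℤ × ℤ)) :
    Measurable (observe a b z₀ F) :=
  measurable_pi_lambda _ fun _ => measurable_circleField a b _

theorem observe_surjective (a b : ℤ) (z₀ : ℤ × ℤ) {ℓ₁ : ℕ} (hℓ₁ : 0 < ℓ₁) (ℓ₂ : ℕ) :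
    Function.Surjective (observe a b z₀ (freeSites ℓ₁ ℓ₂)) := by
  intro y
  obtain ⟨X, hX, hXy⟩ := exists_solution_eq_on_freeSites (a + b) hℓ₁ ℓ₂
    (fun z => if h : z ∈ freeSites ℓ₁ ℓ₂ then y ⟨z, h⟩ else 0)
  obtain ⟨v, hv⟩ := exists_circleField_eq a b (X := fun w => X (-z₀ + w))
    fun z => by rw [groupOp_translate, hX]
  refine ⟨v, funext fun w => ?_⟩
  rw [observe, hv]
  simp only [neg_add_cancel_left]
  rw [hXy w w.2, dif_pos w.2]

theorem map_add_left_naturalMeasure (v : PhaseSpace) :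
    Measure.map (fun u => v + u) naturalMeasure = naturalMeasure := by
  have : (volume : Measure (UnitAddCircle × UnitAddCircle)).IsAddLeftInvariant := by
    rw [Measure.volume_eq_prod]
    infer_instance
  have h := Measure.infinitePi_map_pi
    (μ := fun _ : ℤ => (volume : Measure (UnitAddCircle × UnitAddCircle)))
    (f := fun n p => v n + p) (fun n => measurable_const_add _)
  simp only [map_add_left_eq_self] at h
  exact h

/-- Under the natural measure the state on the free sites is uniformly distributed. -/
theorem map_observe (a b : ℤ) (z₀ : ℤ × ℤ) {ℓ₁ : ℕ} (hℓ₁ : 0 < ℓ₁) (ℓ₂ : ℕ) :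
    Measure.map (observe a b z₀ (freeSites ℓ₁ ℓ₂)) naturalMeasure = volume := by
  set π := observe a b z₀ (freeSites ℓ₁ ℓ₂)
  have hπ : Measurable π := measurable_observe _ _ _ _
  set ρ := Measure.map π naturalMeasure
  have hprob : IsProbabilityMeasure ρ := Measure.isProbabilityMeasure_map hπ.aemeasurable
  have hinv : ρ.IsAddLeftInvariant := ⟨fun y => by
    obtain ⟨v, rfl⟩ := observe_surjective a b z₀ hℓ₁ ℓ₂ y
    have hcomm : (fun x => π v + x) ∘ π = π ∘ fun u => v + u :=
      funext fun u => funext fun w => (circleField_add a b v u _).symm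
    rw [Measure.map_map (measurable_const_add _) hπ]
    change Measure.map ((fun x => π v + x) ∘ π) _ = _
    rw [hcomm, ← Measure.map_map hπ (measurable_const_add _), map_add_left_naturalMeasure]⟩
  -- By surjectivity every translation of the torus lifts to phase space, so `ρ` is an invariant
  -- probability measure on a compact group.
  have hhaar : ρ.IsAddHaarMeasure :=
    Measure.isAddHaarMeasure_of_isCompact_nonempty_interior ρ Set.univ isCompact_univ (by simp)
      (by simp) (by simp)
  exact Measure.isAddHaarMeasure_eq_of_isProbabilityMeasure ρ volume

/-- The representatives in `[0,1)` of uniformly distributed points of a torus are uniformly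
distributed on the cube. -/
theorem volume_lift_preimage {ι : Type*} [Fintype ι] {Q : Set (ι → ℝ)} (hQ : MeasurableSet Q)
    (hQ' : ∀ y ∈ Q, ∀ i, 0 ≤ y i ∧ y i < 1) :
    volume ((fun (x : ι → UnitAddCircle) i => (AddCircle.equivIco 1 0 (x i) : ℝ)) ⁻¹' Q) =
      volume Q := by
  have hlift : MeasurePreserving (fun x : UnitAddCircle => (AddCircle.equivIco 1 0 x : ℝ))
      volume (volume.restrict (Set.Ico 0 1)) := by
    have hmk := AddCircle.measurePreserving_mk 1 0
    have hmeas : Measurable fun x : UnitAddCircle => (AddCircle.equivIco 1 0 x : ℝ) :=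
      measurable_subtype_coe.comp (AddCircle.measurableEquivIco 1 0).measurable
    rw [zero_add, Measure.restrict_congr_set Ico_ae_eq_Ioc.symm] at hmk
    refine ⟨hmeas, ?_⟩
    rw [← hmk.map_eq, Measure.map_map hmeas hmk.measurable]
    conv_rhs => rw [← Measure.map_id (μ := volume.restrict (Set.Ico (0 : ℝ) 1))]
    refine Measure.map_congr ((ae_restrict_iff' measurableSet_Ico).2 (.of_forall fun x hx => ?_))
    rw [Function.comp_apply, AddCircle.equivIco_coe_eq (by simpa using hx)]
    rfl
  have hpi := measurePreserving_pi (fun _ : ι => (volume : Measure UnitAddCircle))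
    (fun _ : ι => (volume : Measure ℝ).restrict (Set.Ico 0 1)) fun _ => hlift
  have hcube : (Q ∩ Set.univ.pi fun _ => Set.Ico (0 : ℝ) 1) = Q :=
    Set.inter_eq_left.2 fun y hy i _ => hQ' y hy i
  refine (hpi.measure_preimage hQ.nullMeasurableSet).trans ?_
  rw [← Measure.restrict_pi_pi, Measure.restrict_apply hQ, hcube]
  rfl

/-! ### The measure of a cylinder -/

/-- Integrality of the symbols makes an admissible field a solution mod 1 over the rectangle. If it
shares the free values of the state, the two agree mod 1 on the closed rectangle, hence exactly,
both being in `[0,1)`. -/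
theorem cylinder_eq_preimage {a b : ℤ} {s : ℝ} (hab : 2 * s = (a : ℝ) + b) (z₀ : ℤ × ℤ)
    {ℓ₁ ℓ₂ : ℕ} (hℓ₁ : 0 < ℓ₁) (hℓ₂ : 0 < ℓ₂) (M : rect ℓ₁ ℓ₂ → ℤ) :
    cylinder a b s z₀ (rect ℓ₁ ℓ₂) M =
      (observe a b z₀ (freeSites ℓ₁ ℓ₂)) ⁻¹'
        ((fun x i => (AddCircle.equivIco 1 0 (x i) : ℝ)) ⁻¹' freeValues s M) := by
  have hc : 2 * s = ((a + b : ℤ) : ℝ) := by rw [hab]; push_cast; rfl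
  have htrans (v : PhaseSpace) (z : ℤ × ℤ) :
      latticeOp s (fun w => field a b v (z₀ + w)) z = latticeOp s (field a b v) (z₀ + z) := by
    rw [latticeOp_eq_groupOp hc, latticeOp_eq_groupOp hc, groupOp_translate]
  ext v
  constructor
  · intro hv
    exact ⟨fun w => field a b v (z₀ + w), ⟨fun z _ => field_mem _ _ _ _,
      fun z => (htrans v z).trans (hv z)⟩, rfl⟩
  · rintro ⟨x, ⟨hx, hM⟩, hxv⟩
    have hfree (w : ℤ × ℤ) (hw : w ∈ freeSites ℓ₁ ℓ₂) : x w = field a b v (z₀ + w) :=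
      congrFun hxv ⟨w, hw⟩
    have hmod : ∀ z ∈ closedRect ℓ₁ ℓ₂,
        ((fun w => (x w : UnitAddCircle)) - fun w => circleField a b v (z₀ + w)) z = 0 := by
      refine eq_zero_on_closedRect (c := a + b) hℓ₁ hℓ₂ (fun z hz => ?_) fun w hw => ?_
      · rw [groupOp_sub, groupOp_translate, groupOp_circleField, sub_zero]
        have := map_groupOp (QuotientAddGroup.mk' (AddSubgroup.zmultiples (1 : ℝ))) (a + b) x z
        refine this.trans ?_
        rw [← latticeOp_eq_groupOp hc, hM ⟨z, hz⟩]
        exact (AddCircle.coe_eq_zero_iff 1).2 ⟨M ⟨z, hz⟩, by simp⟩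
      · rw [Pi.sub_apply, hfree w hw, coe_field, sub_self]
    have heq (z : ℤ × ℤ) (hz : z ∈ closedRect ℓ₁ ℓ₂) : field a b v (z₀ + z) = x z := by
      have h : (x z : UnitAddCircle) = circleField a b v (z₀ + z) := sub_eq_zero.1 (hmod z hz)
      rw [field_eq, ← h, AddCircle.equivIco_coe_eq (by simpa using hx z hz)]
    intro z
    rw [← htrans, ← hM z, latticeOp_eq, latticeOp_eq, heq z (Finset.mem_union_left _ z.2),
      Finset.sum_congr rfl fun w hw => heq w (neighbors_subset_closedRect z.2 hw)]

theorem measure_cylinder {a b : ℤ} {s : ℝ} (hab : 2 * s = (a : ℝ) + b) (hs : 2 < s)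
    (z₀ : ℤ × ℤ) {ℓ₁ ℓ₂ : ℕ} (hℓ₁ : 0 < ℓ₁) (hℓ₂ : 0 < ℓ₂) (M : rect ℓ₁ ℓ₂ → ℤ) :
    naturalMeasure (cylinder a b s z₀ (rect ℓ₁ ℓ₂) M) = volume (freeValues s M) := by
  have hc : 2 * s = ((a + b : ℤ) : ℝ) := by rw [hab]; push_cast; rfl
  have hQ := measurableSet_freeValues hs hc hℓ₁ hℓ₂ M
  have hlift : Measurable fun (x : freeSites ℓ₁ ℓ₂ → UnitAddCircle) i =>
      (AddCircle.equivIco 1 0 (x i) : ℝ) :=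
    measurable_pi_lambda _ fun i => measurable_subtype_coe.comp
      ((AddCircle.measurableEquivIco 1 0).measurable.comp (measurable_pi_apply i))
  rw [cylinder_eq_preimage hab z₀ hℓ₁ hℓ₂,
    ← Measure.map_apply (measurable_observe a b z₀ _) (hlift hQ), map_observe a b z₀ hℓ₁]
  refine volume_lift_preimage hQ ?_
  rintro _ ⟨x, hx, rfl⟩ w
  exact hx.1 w (freeSites_subset_closedRect hℓ₁ hℓ₂ w.2)

theorem measurableSet_cylinder (a b : ℤ) (s : ℝ) (z₀ : ℤ × ℤ) (R : Finset (ℤ × ℤ))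
    (M : R → ℤ) : MeasurableSet (cylinder a b s z₀ R M) := by
  have : cylinder a b s z₀ R M =
      ⋂ z : R, {v | latticeOp s (field a b v) (z₀ + z) = M z} := by
    ext v
    simp [cylinder]
  rw [this]
  refine MeasurableSet.iInter fun z => measurableSet_eq_fun ?_ measurable_const
  have := measurable_field a b
  unfold latticeOp laplacian
  fun_prop

/-- The symbols are integers of the alphabet. -/
theorem exists_symbol {a b : ℤ} {s : ℝ} (hab : 2 * s = (a : ℝ) + b) (hs : 2 < s)
    (v : PhaseSpace) (z : ℤ × ℤ) : ∃ m ∈ alphabet s, latticeOp s (field a b v) z = m := by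
  have hc : 2 * s = ((a + b : ℤ) : ℝ) := by rw [hab]; push_cast; rfl
  have hmod : ((latticeOp s (field a b v) z : ℝ) : UnitAddCircle) = 0 := by
    rw [latticeOp_eq_groupOp hc]
    refine (map_groupOp (QuotientAddGroup.mk' (AddSubgroup.zmultiples (1 : ℝ))) (a + b)
      (field a b v) z).symm.trans ?_
    rw [← groupOp_circleField a b v z]
    congr 1
    exact funext fun w => coe_field a b v w
  obtain ⟨m, hm⟩ := (AddCircle.coe_eq_zero_iff 1).1 hmod
  rw [zsmul_one] at hm
  refine ⟨m, ?_, hm.symm⟩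
  rw [latticeOp_eq, sum_neighbors] at hm
  have h0 := field_mem a b v z
  have h1 := field_mem a b v (z + (0, 1))
  have h2 := field_mem a b v (z - (0, 1))
  have h3 := field_mem a b v (z + (1, 0))
  have h4 := field_mem a b v (z - (1, 0))
  -- The bounds `-4 < m < 2s` are strict; integrality of `m` and of `2s = a + b` sharpens them to
  -- the alphabet.
  constructor
  · have : (-4 : ℝ) < m := by nlinarith
    have : -4 < m := by exact_mod_cast this
    omega
  · have : (m : ℝ) < 2 * s := by nlinarith
    rw [hc] at this ⊢
    have : m < a + b := by exact_mod_cast this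
    have : m ≤ a + b - 1 := by omega
    exact_mod_cast this

theorem tsum_measure_cylinder {a b : ℤ} {s : ℝ} (hab : 2 * s = (a : ℝ) + b) (hs : 2 < s)
    (z₀ : ℤ × ℤ) (R : Finset (ℤ × ℤ)) :
    ∑' M : {M : R → ℤ // ∀ z, M z ∈ alphabet s}, naturalMeasure (cylinder a b s z₀ R M.1) = 1 := by
  rw [← measure_iUnion (μ := naturalMeasure)
    (f := fun M : {M : R → ℤ // ∀ z, M z ∈ alphabet s} => cylinder a b s z₀ R M.1) ?_
    fun M => measurableSet_cylinder a b s z₀ R M.1]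
  · rw [← measure_univ (μ := naturalMeasure)]
    congr 1
    refine Set.eq_univ_of_forall fun v => Set.mem_iUnion.2 ?_
    choose m hm hv using fun z : R => exists_symbol hab hs v (z₀ + z)
    exact ⟨⟨m, hm⟩, hv⟩
  · refine fun M M' hne => Set.disjoint_left.2 fun v hv hv' => hne (Subtype.ext (funext fun z => ?_))
    exact_mod_cast (hv z).symm.trans (hv' z)

/-- The measure of a block is proportional to the volume of its polytope, with factor `dFactor`. -/
theorem measure_cylinder_eq_dFactor_mul {a b : ℤ} {s : ℝ} (hab : 2 * s = (a : ℝ) + b)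
    (hs : 2 < s) (z₀ : ℤ × ℤ) {ℓ₁ ℓ₂ : ℕ} (hℓ₁ : 0 < ℓ₁) (hℓ₂ : 0 < ℓ₂) (M : rect ℓ₁ ℓ₂ → ℤ) :
    naturalMeasure (cylinder a b s z₀ (rect ℓ₁ ℓ₂) M) =
      dFactor s ℓ₁ ℓ₂ * volume (polytope s (rect ℓ₁ ℓ₂) M) := by
  have hc : 2 * s = ((a + b : ℤ) : ℝ) := by rw [hab]; push_cast; rfl
  -- Summing over the blocks of the alphabet, whose cylinders have total measure one, identifies `d`
  -- with `dFactor`.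
  obtain ⟨d, hd⟩ := exists_volume_freeValues hs hc hℓ₁ hℓ₂
  have hcyl (M : rect ℓ₁ ℓ₂ → ℤ) : naturalMeasure (cylinder a b s z₀ (rect ℓ₁ ℓ₂) M) =
      d * volume (polytope s (rect ℓ₁ ℓ₂) M) := by
    rw [measure_cylinder hab hs z₀ hℓ₁ hℓ₂, hd]
  have hsum := tsum_measure_cylinder hab hs z₀ (rect ℓ₁ ℓ₂)
  simp only [hcyl, ENNReal.tsum_mul_left] at hsum
  rw [hcyl, dFactor, ENNReal.eq_inv_of_mul_eq_one_left hsum]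

end CatLattice

theorem mainTheorem4 (a b : ℤ) (s : ℝ) (hab : 2 * s = (a : ℝ) + (b : ℝ)) (hs : 2 < s)
    (ℓ₁ ℓ₂ : ℕ) (hℓ₁ : 0 < ℓ₁) (hℓ₂ : 0 < ℓ₂) :
    -- `dFactor s ℓ₁ ℓ₂` is the constant factor in the measure of every block
    (∀ M : CatLattice.rect ℓ₁ ℓ₂ → ℤ, (∀ z, M z ∈ CatLattice.alphabet s) → ∀ z₀ : ℤ × ℤ,
      CatLattice.naturalMeasure (CatLattice.cylinder a b s z₀ (CatLattice.rect ℓ₁ ℓ₂) M) =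
        CatLattice.dFactor s ℓ₁ ℓ₂ *
          MeasureTheory.volume (CatLattice.polytope s (CatLattice.rect ℓ₁ ℓ₂) M)) ∧
    -- blocks of interior symbols
    (∀ M : CatLattice.rect ℓ₁ ℓ₂ → ℤ, (∀ z, M z ∈ CatLattice.interiorAlphabet s) →
      CatLattice.polytope s (CatLattice.rect ℓ₁ ℓ₂) M =
          CatLattice.hypercube (CatLattice.rect ℓ₁ ℓ₂) ∧
        MeasureTheory.volume (CatLattice.polytope s (CatLattice.rect ℓ₁ ℓ₂) M) = 1 ∧
        ∀ z₀ : ℤ × ℤ,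
          CatLattice.naturalMeasure (CatLattice.cylinder a b s z₀ (CatLattice.rect ℓ₁ ℓ₂) M) =
            CatLattice.dFactor s ℓ₁ ℓ₂) := by
  refine ⟨fun M _ z₀ => CatLattice.measure_cylinder_eq_dFactor_mul hab hs z₀ hℓ₁ hℓ₂ M,
    fun M hM => ?_⟩
  have hcube := CatLattice.polytope_eq_hypercube hs hℓ₁ hℓ₂ hM
  have hvol : volume (CatLattice.polytope s (CatLattice.rect ℓ₁ ℓ₂) M) = 1 := by
    rw [hcube, CatLattice.hypercube_volume]
  refine ⟨hcube, hvol, fun z₀ => ?_⟩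
  rw [CatLattice.measure_cylinder_eq_dFactor_mul hab hs z₀ hℓ₁ hℓ₂, hvol, mul_one]
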